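/- Let $A$, $B$, $C$ be finite dimensional algebras over a field $k$. For such an algebra $\Lambda$, let $D^b(\mathrm{mod}\text{-}\Lambda)$ be the bounded derived category of finite dimensional right $\Lambda$-modules. An object $X$ of $D^b(\mathrm{mod}\text{-}\Lambda)$ is called compact if it is isomorphic to a bounded complex of finitely generated projective $\Lambda$-modules. A compact $X$ has a minimal representative of this kind, that is, one without direct summands of the form $P\xrightarrow{\mathrm{id}}P$ (or shifts of these) with $P$ a nonzero finitely generated projective module; it is unique up to isomorphism of complexes. If this representative is $0\to P_{-s}\to\cdots\to P_r\to 0$ with $P_{-s}\ne 0\ne P_r$, then $\mathrm{length}(X):=s+r$, and $\mathrm{length}(0):=0$. The strong global dimension $\mathrm{sgldim}(\Lambda)\in\mathbb{N}\cup\{\infty\}$ is the supremum of the lengths of all indecomposable compact objects of $D^b(\mathrm{mod}\text{-}\Lambda)$ (and $0$ if there are none). Suppose that $D^b(\mathrm{mod}\text{-}A)$ is a recollement of $D^b(\mathrm{mod}\text{-}B)$ and $D^b(\mathrm{mod}\text{-}C)$, that is, there are triangle functors $$i^*, i^!: D^b(\mathrm{mod}\text{-}A)\to D^b(\mathrm{mod}\text{-}B),\quad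 i_*=i_!: D^b(\mathrm{mod}\text{-}B)\to D^b(\mathrm{mod}\text{-}A),$$ $$j_!, j_*: D^b(\mathrm{mod}\text{-}C)\to D^b(\mathrm{mod}\text{-}A),\quad j^!=j^*: D^b(\mathrm{mod}\text{-}A)\to D^b(\mathrm{mod}\text{-}C)$$ such that $(i^*,i_*)$, $(i_!,i^!)$, $(j_!,j^!)$, $(j^*,j_*)$ are adjoint pairs; $i_*$, $j_*$, $j_!$ are fully faithful; $i^!\circ j_*=0$; and for each object $Z$ of $D^b(\mathrm{mod}\text{-}A)$ there are distinguished triangles $i_!i^!Z\to Z\to j_*j^*Z\to$ and $j_!j^!Z\to Z\to i_*i^*Z\to$. If $\mathrm{sgldim}(A)<\infty$, then $\mathrm{sgldim}(B)<\infty$ and $\mathrm{sgldim}(C)<\infty$. More precisely, the object $i_*(B)$ is compact and $$\mathrm{sgldim}(B)\le \mathrm{sgldim}(A)+\mathrm{length}(i_*(B)).$$ -/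

import Mathlib

open CategoryTheory CategoryTheory.Limits CategoryTheory.Pretriangulated

universe v v₁ v₂ v₃ w u u₁ u₂ u₃

section Recollement

variable (Y : Type u₁) (D : Type u₂) (X : Type u₃)
  [Category.{v₁} Y] [Category.{v₂} D] [Category.{v₃} X]
  [Preadditive Y] [Preadditive D] [Preadditive X]
  [HasZeroObject Y] [HasZeroObject D] [HasZeroObject X]
  [HasShift Y ℤ] [HasShift D ℤ] [HasShift X ℤ]
  [∀ n : ℤ, (shiftFunctor Y n).Additive] [∀ n : ℤ, (shiftFunctor D n).Additive]
  [∀ n : ℤ, (shiftFunctor X n).Additive]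
  [Pretriangulated Y] [Pretriangulated D] [Pretriangulated X]

/-- A recollement of the triangulated category `D` relative to `Y` (left-hand side) and `X`
(right-hand side): six triangle functors
`i^* : D ⥤ Y`, `i_* = i_! : Y ⥤ D`, `i^! : D ⥤ Y`,
`j_! : X ⥤ D`, `j^! = j^* : D ⥤ X`, `j_* : X ⥤ D`. -/
structure Recollement where
  /-- `i^*` -/
  iPull : D ⥤ Y
  /-- `i_* = i_!` -/
  iPush : Y ⥤ D
  /-- `i^!` -/
  iShriek : D ⥤ Y
  /-- `j_!` -/
  jShriek : X ⥤ D
  /-- `j^! = j^*` -/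
  jPull : D ⥤ X
  /-- `j_*` -/
  jPush : X ⥤ D
  [iPull_commShift : iPull.CommShift ℤ]
  [iPush_commShift : iPush.CommShift ℤ]
  [iShriek_commShift : iShriek.CommShift ℤ]
  [jShriek_commShift : jShriek.CommShift ℤ]
  [jPull_commShift : jPull.CommShift ℤ]
  [jPush_commShift : jPush.CommShift ℤ]
  [iPull_triangulated : iPull.IsTriangulated]
  [iPush_triangulated : iPush.IsTriangulated]
  [iShriek_triangulated : iShriek.IsTriangulated]
  [jShriek_triangulated : jShriek.IsTriangulated]
  [jPull_triangulated : jPull.IsTriangulated]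
  [jPush_triangulated : jPush.IsTriangulated]
  /-- `(i^*, i_*)` is an adjoint pair. -/
  adj₁ : iPull ⊣ iPush
  /-- `(i_!, i^!)` is an adjoint pair. -/
  adj₂ : iPush ⊣ iShriek
  /-- `(j_!, j^!)` is an adjoint pair. -/
  adj₃ : jShriek ⊣ jPull
  /-- `(j^*, j_*)` is an adjoint pair. -/
  adj₄ : jPull ⊣ jPush
  [iPush_full : iPush.Full]
  [iPush_faithful : iPush.Faithful]
  [jPush_full : jPush.Full]
  [jPush_faithful : jPush.Faithful]
  [jShriek_full : jShriek.Full]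
  [jShriek_faithful : jShriek.Faithful]
  /-- `i^! ∘ j_* = 0` -/
  iShriek_jPush_isZero : ∀ Z : X, IsZero (iShriek.obj (jPush.obj Z))
  /-- There is a triangle `i_! i^! Z ⟶ Z ⟶ j_* j^* Z ⟶`. -/
  exists_triangle₁ : ∀ Z : D, ∃ (f : iPush.obj (iShriek.obj Z) ⟶ Z)
    (g : Z ⟶ jPush.obj (jPull.obj Z))
    (h : jPush.obj (jPull.obj Z) ⟶ (iPush.obj (iShriek.obj Z))⟦(1 : ℤ)⟧),
    Triangle.mk f g h ∈ distTriang D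
  /-- There is a triangle `j_! j^! Z ⟶ Z ⟶ i_* i^* Z ⟶`. -/
  exists_triangle₂ : ∀ Z : D, ∃ (f : jShriek.obj (jPull.obj Z) ⟶ Z)
    (g : Z ⟶ iPush.obj (iPull.obj Z))
    (h : iPush.obj (iPull.obj Z) ⟶ (jShriek.obj (jPull.obj Z))⟦(1 : ℤ)⟧),
    Triangle.mk f g h ∈ distTriang D

end Recollement

section Algebras

variable (k : Type v) [Field k] (A : Type u) [Ring A] [Algebra k A] [Module.Finite k A]

/-- The opposite of a finite dimensional algebra is noetherian. -/
theorem isNoetherianRing_mulOpposite_of_finite (k : Type v) [Field k] (A : Type u) [Ring A]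
    [Algebra k A] [Module.Finite k A] : IsNoetherianRing Aᵐᵒᵖ :=
  IsNoetherianRing.of_finite k Aᵐᵒᵖ

/-- `A` is a finitely generated right module over itself. -/
instance finite_mulOpposite_self (A : Type u) [Ring A] : Module.Finite Aᵐᵒᵖ A :=
  ⟨⟨{1}, by
    rw [Finset.coe_singleton, eq_top_iff]
    intro a _
    exact Submodule.mem_span_singleton.2 ⟨MulOpposite.op a, by simp⟩⟩⟩

/-- `mod-A`: the category of finitely generated (equivalently, finite dimensional) right
modules over the finite dimensional `k`-algebra `A`; a right `A`-module is a left module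
over `Aᵐᵒᵖ`. The base field is recorded only to make the category abelian. -/
@[nolint unusedArguments]
def FDMod (k : Type v) [Field k] (A : Type u) [Ring A] [Algebra k A] [Module.Finite k A] :
    Type (u + 1) :=
  FGModuleCat.{u} Aᵐᵒᵖ

noncomputable section

instance : Category.{u} (FDMod k A) :=
  inferInstanceAs (Category.{u} (FGModuleCat.{u} Aᵐᵒᵖ))

instance : Abelian (FDMod k A) :=
  haveI := isNoetherianRing_mulOpposite_of_finite k A
  inferInstanceAs (Abelian (FGModuleCat.{u} Aᵐᵒᵖ))

instance : HasDerivedCategory (FDMod k A) :=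
  HasDerivedCategory.standard (FDMod k A)

/-- `D^b(mod-A)`, the full subcategory of the derived category of `mod-A` consisting of the
objects with bounded cohomology. -/
abbrev Db : Type (u + 1) := DerivedCategory.Bounded (FDMod k A)

/-- The right `A`-module `A`. -/
def regularModule : FDMod k A :=
  FGModuleCat.of Aᵐᵒᵖ A

/-- The right `A`-module `A`, as an object of `D^b(mod-A)` concentrated in degree `0`. -/
def regularObject : Db k A :=
  ⟨(DerivedCategory.singleFunctor (FDMod k A) 0).obj (regularModule k A),
    ⟨0, inferInstance⟩, ⟨0, inferInstance⟩⟩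

variable {k A}

/-- `K` is an object of `K^b(P_A)` which represents `X`: a bounded complex of finitely
generated projective modules that is isomorphic to `X` in the derived category. -/
structure IsProjRep (K : CochainComplex (FDMod k A) ℤ) (X : Db k A) : Prop where
  bounded_below : ∃ a : ℤ, K.IsStrictlyGE a
  bounded_above : ∃ b : ℤ, K.IsStrictlyLE b
  projective : ∀ n : ℤ, Projective (K.X n)
  iso : Nonempty (X.obj ≅ DerivedCategory.Q.obj K)

/-- A minimal `K^b(P_A)`-representative of `X`: one without nonzero direct summands of the form
`⋯ ⟶ 0 ⟶ P ⟶ P ⟶ 0 ⟶ ⋯` with the identity of `P` in the middle. -/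
structure IsMinimalProjRep (K : CochainComplex (FDMod k A) ℤ) (X : Db k A) : Prop
    extends IsProjRep K X where
  isZero_of_retract : ∀ (n : ℤ) (P : FDMod k A), Projective P →
    Nonempty (Retract (HomologicalComplex.double (𝟙 P)
      (show (ComplexShape.up ℤ).Rel n (n + 1) from rfl)) K) → IsZero P

/-- `X` is compact (perfect), i.e. it belongs to `K^b(P_A)`. -/
def IsPerfect (X : Db k A) : Prop :=
  ∃ K : CochainComplex (FDMod k A) ℤ, IsProjRep K X

/-- The length `r + s` of a complex
`0 ⟶ P_{-s} ⟶ ⋯ ⟶ P_r ⟶ 0` with `P_{-s}` and `P_r` nonzero (and `0` for the zero complex). -/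
def complexLength (K : CochainComplex (FDMod k A) ℤ) : ℕ∞ :=
  ⨆ (i : ℤ) (j : ℤ) (_ : ¬ IsZero (K.X i)) (_ : ¬ IsZero (K.X j)), ((j - i).toNat : ℕ∞)

/-- The length of the minimal `K^b(P_A)`-representative of a compact object `X`. The minimal
representative is unique up to isomorphism of complexes, so that the infimum is over a single
value; it is `⊤` if `X` is not compact. -/
def objLength (X : Db k A) : ℕ∞ :=
  ⨅ (K : CochainComplex (FDMod k A) ℤ) (_ : IsMinimalProjRep K X), complexLength K

variable (k A)

/-- The strong global dimension of `A`: the supremum of the lengths of the indecomposable compact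
objects of `D^b(mod-A)`. -/
def strongGlobalDim : ℕ∞ :=
  ⨆ (X : Db k A) (_ : IsPerfect X) (_ : Indecomposable X), objLength X

end

end Algebras

/-!
The functors `i_*` and `j_!` of a recollement are both fully faithful and have right adjoints
`i^!` and `j^!`, and this is all that the theorem needs. Let `F : D^b(mod-B) ⥤ D^b(mod-A)` be a
fully faithful triangle functor with a right adjoint `G`.

*`F` preserves perfect objects* (`IsPerfect.map_of_adjunction`). If `X` is perfect and `W` is a
bounded complex, then `Hom(F X, W[n]) = Hom(X, (G W)[n])` vanishes for `n` large. Conversely an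
object `X` of `D^b(mod-A)` with cohomology in degrees `≥ a` is perfect as soon as it has no
nonzero morphism to a module placed in degree `a - 1` (`isPerf_of_hom_single_eq_zero`). Such a
vanishing is stable under extensions and retracts of modules, so it only has to be checked for
`A / rad A` (`FGModuleCat.induction_of_jacobson`), which makes a single bound on `n` sufficient.

*`F` preserves indecomposable objects* (`Indecomposable.map_of_adjunction`), since its essential
image is closed under direct summands.

*Lengths are read off from the regular module.* Let `K` be a minimal complex of projectives
representing `Y`, with lowest nonzero degree `a` and highest nonzero degree `b`. By minimality the
identity of `K^a` does not factor through `K^a ⟶ K^{a+1}`, and `K^{b-1} ⟶ K^b` is not a split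
epimorphism. Since morphisms out of a bounded complex of projectives in the derived category are
homotopy classes of chain maps, and finitely generated projectives are built from `B`, there are
nonzero morphisms `Y ⟶ B[-a]` and `B ⟶ Y[b]`. Their images `F Y ⟶ (F B)[-a]` and
`F B ⟶ (F Y)[b]` are nonzero too; if `F Y` is represented by projectives in degrees `[e, f]` and
`F B` by projectives in degrees `[c, d]`, then a nonzero morphism to a shift forces overlapping
supports, so `-a ≤ d - e` and `b ≤ f - c`. Hence `b - a ≤ (f - e) + (d - c)`, which is
`complexLength_le_add_of_faithful`.

Minimal representatives exist because splitting off contractible summands lowers the total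
composition length (`IsPerfect.exists_isMinimalProjRep`), and they have finite length, so the
resulting inequality also gives the finiteness of the strong global dimensions.
-/

/-! ### Morphisms and perfect objects in the derived category -/

section DerivedAbelian

variable {𝒜 : Type u} [Category.{v} 𝒜] [Abelian 𝒜] [HasDerivedCategory.{w} 𝒜]

open DerivedCategory

lemma exists_Q_map_eq_of_isKProjective {K L : CochainComplex 𝒜 ℤ} [K.IsKProjective]
    (f : Q.obj K ⟶ Q.obj L) : ∃ φ : K ⟶ L, Q.map φ = f := by
  obtain ⟨g, hg⟩ := (CochainComplex.IsKProjective.Qh_map_bijective K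
    ((HomotopyCategory.quotient _ _).obj L)).surjective
      ((quotientCompQhIso 𝒜).hom.app K ≫ f ≫ (quotientCompQhIso 𝒜).inv.app L)
  obtain ⟨φ, rfl⟩ := (HomotopyCategory.quotient _ _).map_surjective g
  refine ⟨φ, ?_⟩
  have h := quotientCompQhIso_hom_naturality φ
  rw [hg] at h
  simpa using h.symm

lemma nonempty_homotopy_zero_of_Q_map_eq_zero {K L : CochainComplex 𝒜 ℤ} [K.IsKProjective]
    {φ : K ⟶ L} (h : Q.map φ = 0) : Nonempty (Homotopy φ 0) := by
  refine ⟨HomotopyCategory.homotopyOfEq _ _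
    ((CochainComplex.IsKProjective.Qh_map_bijective K
      ((HomotopyCategory.quotient _ _).obj L)).injective ?_)⟩
  have h' := quotientCompQhIso_hom_naturality φ
  rw [h, comp_zero] at h'
  rw [Functor.map_zero, Functor.map_zero, ← cancel_mono ((quotientCompQhIso 𝒜).hom.app L), h',
    zero_comp]

lemma eq_zero_of_isKProjective_of_isZero {K L : CochainComplex 𝒜 ℤ} [K.IsKProjective]
    (h : ∀ i, IsZero (K.X i) ∨ IsZero (L.X i)) (f : Q.obj K ⟶ Q.obj L) : f = 0 := by
  obtain ⟨φ, rfl⟩ := exists_Q_map_eq_of_isKProjective f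
  have : φ = 0 := by
    ext i
    rcases h i with h | h
    · exact h.eq_of_src _ _
    · exact h.eq_of_tgt _ _
  rw [this, Functor.map_zero]

lemma exists_not_isZero_of_ne_zero {K L : CochainComplex 𝒜 ℤ} [K.IsKProjective]
    {X Y : DerivedCategory 𝒜} (eX : X ≅ Q.obj K) (eY : Y ≅ Q.obj L) {n : ℤ} {f : X ⟶ Y⟦n⟧}
    (hf : f ≠ 0) : ∃ i, ¬ IsZero (K.X i) ∧ ¬ IsZero (L.X (i + n)) := by
  by_contra! H
  apply hf
  have := eq_zero_of_isKProjective_of_isZero (K := K) (L := L⟦n⟧)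
    (fun i ↦ or_iff_not_imp_left.2 (H i))
    (eX.inv ≫ f ≫ eY.hom⟦n⟧' ≫ (Q.commShiftIso n).inv.app L)
  rw [← cancel_epi eX.inv, comp_zero, ← cancel_mono (eY.hom⟦n⟧'), zero_comp,
    ← cancel_mono ((Q.commShiftIso n).inv.app L), zero_comp]
  simpa using this

omit [HasDerivedCategory 𝒜] in
lemma projective_single_X (P : 𝒜) [Projective P] (n i : ℤ) :
    Projective (((HomologicalComplex.single 𝒜 (ComplexShape.up ℤ) n).obj P).X i) := by
  by_cases h : i = n
  · subst h
    exact Projective.of_iso (HomologicalComplex.singleObjXSelf _ _ P).symm inferInstance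
  · exact (HomologicalComplex.isZero_single_obj_X _ _ P _ h).projective

/-- A contractible two-term complex vanishes in the derived category. -/
lemma isZero_Q_double_id (P : 𝒜) (n : ℤ) :
    IsZero (Q.obj (HomologicalComplex.double (𝟙 P)
      (show (ComplexShape.up ℤ).Rel n (n + 1) from rfl))) := by
  set D := HomologicalComplex.double (𝟙 P) (show (ComplexShape.up ℤ).Rel n (n + 1) from rfl)
  have hn : n ≠ n + 1 := by lia
  have hd : IsIso (D.d n (n + 1)) := by
    rw [HomologicalComplex.double_d _ _ hn]
    infer_instance
  have hz (k : ℤ) (h₀ : k ≠ n) (h₁ : k ≠ n + 1) : IsZero (D.X k) :=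
    HomologicalComplex.isZero_double_X _ _ k h₀ h₁
  have hD : D.Acyclic := by
    intro i
    by_cases h₀ : i = n
    · rw [h₀, HomologicalComplex.exactAt_iff' _ (n - 1) n (n + 1) (by simp) (by simp),
        ShortComplex.exact_iff_mono _ ((hz (n - 1) (by lia) (by lia)).eq_of_src _ _)]
      exact inferInstanceAs (Mono (D.d n (n + 1)))
    · by_cases h₁ : i = n + 1
      · rw [h₁, HomologicalComplex.exactAt_iff' _ n (n + 1) (n + 1 + 1) (by simp) (by simp),
          ShortComplex.exact_iff_epi _ ((hz (n + 1 + 1) (by lia) (by lia)).eq_of_tgt _ _)]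
        exact inferInstanceAs (Epi (D.d n (n + 1)))
      · exact ShortComplex.exact_of_isZero_X₂ _ (hz i h₀ h₁)
  have : CochainComplex.IsLE D 0 := (CochainComplex.isLE_iff D 0).2 fun i _ ↦ hD i
  have : CochainComplex.IsGE D 1 := (CochainComplex.isGE_iff D 1).2 fun i _ ↦ hD i
  exact TStructure.t.isZero (Q.obj D) 0 1 (by lia)

lemma exists_distTriang_mappingCone {K L : CochainComplex 𝒜 ℤ} (φ : K ⟶ L) :
    ∃ h : Q.obj (CochainComplex.mappingCone φ) ⟶ (Q.obj K)⟦(1 : ℤ)⟧,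
      Triangle.mk (Q.map φ) (Q.map (CochainComplex.mappingCone.inr φ)) h ∈
        distTriang (DerivedCategory 𝒜) :=
  ⟨_, mappingCone_triangle_distinguished φ⟩

lemma exists_distTriang_single {S : ShortComplex 𝒜} (hS : S.ShortExact) (n : ℤ) :
    ∃ h : (singleFunctor 𝒜 n).obj S.X₃ ⟶ ((singleFunctor 𝒜 n).obj S.X₁)⟦(1 : ℤ)⟧,
      Triangle.mk ((singleFunctor 𝒜 n).map S.f) ((singleFunctor 𝒜 n).map S.g) h ∈
        distTriang (DerivedCategory 𝒜) :=
  ⟨_, triangleOfSES_distinguished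
    (hS.map_of_exact (HomologicalComplex.single 𝒜 (ComplexShape.up ℤ) n))⟩

/-- Vanishing of the morphisms from a fixed object to modules placed in a fixed degree is closed
under extensions. -/
lemma hom_single_eq_zero_of_shortExact (X : DerivedCategory 𝒜) (n : ℤ) {S : ShortComplex 𝒜}
    (hS : S.ShortExact) (h₁ : ∀ f : X ⟶ (singleFunctor 𝒜 n).obj S.X₁, f = 0)
    (h₃ : ∀ f : X ⟶ (singleFunctor 𝒜 n).obj S.X₃, f = 0)
    (f : X ⟶ (singleFunctor 𝒜 n).obj S.X₂) : f = 0 := by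
  obtain ⟨h, hT⟩ := exists_distTriang_single hS n
  obtain ⟨g, rfl⟩ := Triangle.coyoneda_exact₂ _ hT f (h₃ _)
  rw [h₁ g]
  exact zero_comp

/-- An object all of whose first extension groups vanish, as seen in the derived category, is
projective: its projective presentation splits. -/
lemma projective_of_hom_single_eq_zero [EnoughProjectives 𝒜] {M : 𝒜} {a : ℤ}
    (h : ∀ (N : 𝒜) (f : (singleFunctor 𝒜 a).obj M ⟶ (singleFunctor 𝒜 (a - 1)).obj N), f = 0) :
    Projective M := by
  let S : ShortComplex 𝒜 := ShortComplex.mk (kernel.ι (Projective.π M)) (Projective.π M) (by simp)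
  have hS : S.ShortExact :=
    { exact := ShortComplex.exact_of_f_is_kernel _ (kernelIsKernel _) }
  obtain ⟨δ, hT⟩ := exists_distTriang_single hS a
  let e := ((singleFunctors 𝒜).shiftIso 1 (a - 1) a (by lia)).app S.X₁
  have hδ : δ = 0 := by
    have h' := h _ (δ ≫ e.hom)
    rwa [← zero_comp (f := e.hom), cancel_mono] at h'
  obtain ⟨g, hg⟩ := Triangle.coyoneda_exact₃ _ hT (𝟙 ((singleFunctor 𝒜 a).obj M))
    ((Category.id_comp _).trans hδ)
  obtain ⟨g, rfl⟩ := (singleFunctor 𝒜 a).map_surjective g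
  have : g ≫ Projective.π M = 𝟙 M := (singleFunctor 𝒜 a).map_injective (by
    rw [CategoryTheory.Functor.map_comp, CategoryTheory.Functor.map_id]; exact hg.symm)
  exact Retract.projective ⟨g, _, this⟩ 

/-- An object of the derived category which is isomorphic to a bounded complex of projective
objects. -/
def IsPerf (X : DerivedCategory 𝒜) : Prop :=
  ∃ K : CochainComplex 𝒜 ℤ, (∃ a : ℤ, K.IsStrictlyGE a) ∧ (∃ b : ℤ, K.IsStrictlyLE b) ∧
    (∀ n : ℤ, Projective (K.X n)) ∧ Nonempty (X ≅ Q.obj K)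

lemma IsPerf.of_iso {X Y : DerivedCategory 𝒜} (hX : IsPerf X) (e : Y ≅ X) : IsPerf Y := by
  obtain ⟨K, ha, hb, hK, ⟨e'⟩⟩ := hX
  exact ⟨K, ha, hb, hK, ⟨e ≪≫ e'⟩⟩

lemma isPerf_single (P : 𝒜) [Projective P] (n : ℤ) : IsPerf ((singleFunctor 𝒜 n).obj P) :=
  ⟨(HomologicalComplex.single 𝒜 (ComplexShape.up ℤ) n).obj P, ⟨n, inferInstance⟩,
    ⟨n, inferInstance⟩, projective_single_X P n, ⟨Iso.refl _⟩⟩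

lemma IsPerf.shift {X : DerivedCategory 𝒜} (hX : IsPerf X) (n : ℤ) : IsPerf (X⟦n⟧) := by
  obtain ⟨K, ⟨a, _⟩, ⟨b, _⟩, hK, ⟨e⟩⟩ := hX
  exact ⟨K⟦n⟧, ⟨a - n, K.isStrictlyGE_shift a n _ (by lia)⟩,
    ⟨b - n, K.isStrictlyLE_shift b n _ (by lia)⟩, fun i ↦ hK (i + n),
    ⟨(shiftFunctor _ n).mapIso e ≪≫ (Q.commShiftIso n).symm.app K⟩⟩

lemma IsPerf.cone {T : Triangle (DerivedCategory 𝒜)} (hT : T ∈ distTriang _)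
    (h₁ : IsPerf T.obj₁) (h₂ : IsPerf T.obj₂) : IsPerf T.obj₃ := by
  obtain ⟨K, ⟨a, _⟩, ⟨b, _⟩, hK, ⟨e⟩⟩ := h₁
  obtain ⟨L, ⟨c, _⟩, ⟨d, _⟩, hL, ⟨e'⟩⟩ := h₂
  have := CochainComplex.isKProjective_of_projective K b
  obtain ⟨φ, hφ⟩ := exists_Q_map_eq_of_isKProjective (e.inv ≫ T.mor₁ ≫ e'.hom)
  obtain ⟨δ, hδ⟩ := exists_distTriang_mappingCone φ
  refine ⟨CochainComplex.mappingCone φ,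
    ⟨min (a - 1) c, CochainComplex.isStrictlyGE_mappingCone φ a c _⟩,
    ⟨max b d, (CochainComplex.isStrictlyLE_iff _ _).2 fun i hi ↦ ?_⟩, fun n ↦ ?_,
    ⟨Triangle.π₃.mapIso (isoTriangleOfIso₁₂ T
      (Triangle.mk (Q.map φ) (Q.map (CochainComplex.mappingCone.inr φ)) δ) hT hδ e e'
      (by change T.mor₁ ≫ e'.hom = e.hom ≫ Q.map φ; rw [hφ, e.hom_inv_id_assoc]))⟩⟩
  · rw [CochainComplex.mappingCone.isZero_X_iff]
    exact ⟨K.isZero_of_isStrictlyLE b _, L.isZero_of_isStrictlyLE d _⟩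
  · exact Projective.of_iso (HomologicalComplex.homotopyCofiber.XIsoBiprod φ n (n + 1) rfl).symm
      inferInstance

lemma IsPerf.extension {T : Triangle (DerivedCategory 𝒜)} (hT : T ∈ distTriang _)
    (h₁ : IsPerf T.obj₁) (h₃ : IsPerf T.obj₃) : IsPerf T.obj₂ :=
  IsPerf.cone (inv_rot_of_distTriang _ hT) (h₃.shift (-1)) h₁

open HomologicalComplex in
/-- An object with cohomology in degrees `≥ a` is perfect as soon as it has no morphisms to
modules placed in degree `a - 1`: killing the top cohomology successively by projectives leaves
a single module in degree `a`, which is then projective. -/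
lemma isPerf_of_hom_single_eq_zero [EnoughProjectives 𝒜] (a : ℤ) (m : ℕ) :
    ∀ (X : DerivedCategory 𝒜) [X.IsGE a] [X.IsLE (a + m)],
      (∀ (N : 𝒜) (f : X ⟶ (singleFunctor 𝒜 (a - 1)).obj N), f = 0) → IsPerf X := by
  induction m with
  | zero =>
    intro X _ hX h
    rw [Nat.cast_zero, add_zero] at hX
    obtain ⟨M, ⟨e⟩⟩ := exists_iso_singleFunctor_obj_of_isGE_of_isLE X a
    have : Projective M := projective_of_hom_single_eq_zero (a := a) fun N f ↦ by
      rw [← cancel_epi e.hom, h N (e.hom ≫ f), comp_zero]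
    exact (isPerf_single M a).of_iso e
  | succ m ih =>
    intro X _ hX h
    set b : ℤ := a + ((m + 1 : ℕ) : ℤ) with hb
    obtain ⟨L, _, _, ⟨e⟩⟩ := exists_iso_Q_obj_of_isGE_of_isLE X a b
    -- The cone of a map from a projective onto the top term of `L` has no cohomology in degree `b`.
    let φ : (single 𝒜 (ComplexShape.up ℤ) b).obj (Projective.over (L.X b)) ⟶ L :=
      mkHomFromSingle (Projective.π (L.X b)) fun k hk ↦
        (L.isZero_of_isStrictlyLE b k (by have : b + 1 = k := hk; lia)).eq_of_tgt _ _
    obtain ⟨δ, hT⟩ := exists_distTriang_mappingCone φ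
    have hGE : (CochainComplex.mappingCone φ).IsStrictlyGE a :=
      CochainComplex.isStrictlyGE_mappingCone φ b a a
    have hz : IsZero (((single 𝒜 (ComplexShape.up ℤ) b).obj
        (Projective.over (L.X b))).X (b + 1)) := isZero_single_obj_X _ _ _ _ (by lia)
    have hLE : (CochainComplex.mappingCone φ).IsLE (a + m) := by
      rw [CochainComplex.isLE_iff]
      intro i hi
      by_cases hib : i = b
      · rw [hib, exactAt_iff' _ (b - 1) b (b + 1) (by simp) (by simp),
          ShortComplex.exact_iff_epi _ (IsZero.eq_of_tgt (by
            change IsZero ((CochainComplex.mappingCone φ).X (b + 1))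
            rw [CochainComplex.mappingCone.isZero_X_iff]
            exact ⟨isZero_single_obj_X _ _ _ _ (by lia), L.isZero_of_isStrictlyLE b _⟩) _ _)]
        have h₁ : Epi (φ.f b) := by
          dsimp only [φ]
          rw [mkHomFromSingle_f]
          infer_instance
        have h₂ : Epi ((CochainComplex.mappingCone.inr φ).f b) := ⟨fun u v huv ↦
          CochainComplex.mappingCone.ext_from φ (b + 1) b rfl (hz.eq_of_src _ _) huv⟩
        have h₃ := CochainComplex.mappingCone.inl_v_d φ b (b - 1) (b + 1) (by lia) (by lia)
        rw [single_obj_d, zero_comp, sub_zero] at h₃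
        have h₄ : Epi ((CochainComplex.mappingCone.inl φ).v b (b - 1) (by lia) ≫
          (CochainComplex.mappingCone φ).d (b - 1) b) := by
          rw [h₃]
          infer_instance
        exact epi_of_epi ((CochainComplex.mappingCone.inl φ).v b (b - 1) _)
          ((CochainComplex.mappingCone φ).d (b - 1) b)
      · apply ShortComplex.exact_of_isZero_X₂
        change IsZero ((CochainComplex.mappingCone φ).X i)
        rw [CochainComplex.mappingCone.isZero_X_iff]
        exact ⟨isZero_single_obj_X _ _ _ _ (by lia), L.isZero_of_isStrictlyLE b _ (by lia)⟩
    refine (IsPerf.extension hT (isPerf_single (Projective.over (L.X b)) b)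
      (ih (Q.obj (CochainComplex.mappingCone φ)) fun N f ↦ ?_)).of_iso e
    obtain ⟨g, rfl⟩ := Triangle.yoneda_exact₃ _ hT f (by
      have h' := h _ (e.hom ≫ Q.map (CochainComplex.mappingCone.inr φ) ≫ f)
      rwa [← comp_zero (f := e.hom), cancel_epi] at h')
    have hP' := projective_single_X (Projective.over (L.X b)) b
    have hP := CochainComplex.isKProjective_of_projective ((single 𝒜 (ComplexShape.up ℤ) b).obj
      (Projective.over (L.X b))) b
    -- The shifted projective lives in degree `b - 1 > a - 1`, so it does not meet `N`.
    have hg (g : (Q.obj ((single 𝒜 (ComplexShape.up ℤ) b).obj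
        (Projective.over (L.X b))))⟦(1 : ℤ)⟧ ⟶ (singleFunctor 𝒜 (a - 1)).obj N) : g = 0 := by
      let c := (Q.commShiftIso (1 : ℤ)).app ((single 𝒜 (ComplexShape.up ℤ) b).obj
        (Projective.over (L.X b)))
      have h' : c.hom ≫ g = 0 := by
        refine eq_zero_of_isKProjective_of_isZero
          (L := (single 𝒜 (ComplexShape.up ℤ) (a - 1)).obj N) (fun i ↦ ?_) _
        by_cases hi : i = a - 1
        · exact Or.inl (isZero_single_obj_X (ComplexShape.up ℤ) b _ (i + 1) (by lia))
        · exact Or.inr (isZero_single_obj_X _ _ _ _ hi)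
      rwa [← comp_zero (f := c.hom), cancel_epi] at h'
    rw [hg g]
    exact comp_zero

end DerivedAbelian

/-! ### Minimal complexes of projectives -/

section MinimalComplexes

variable {𝒜 : Type u} [Category.{v} 𝒜] [Abelian 𝒜]

open HomologicalComplex

/-- Morphisms to the two-term complex `P ⟶ P` given by the identity can be built from
compatible maps in its two degrees. -/
lemma exists_hom_to_double_id {P : 𝒜} {n : ℤ} {K : CochainComplex 𝒜 ℤ}
    (φ₀ : K.X n ⟶ P) (φ₁ : K.X (n + 1) ⟶ P) (comm : K.d n (n + 1) ≫ φ₁ = φ₀)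
    (h : ∀ i, i + 1 = n → K.d i n ≫ φ₀ = 0) :
    ∃ φ : K ⟶ double (𝟙 P) (show (ComplexShape.up ℤ).Rel n (n + 1) from rfl),
      φ.f n = φ₀ ≫ (doubleXIso₀ _ _).inv ∧
        φ.f (n + 1) = φ₁ ≫ (doubleXIso₁ _ _ (by lia)).inv := by
  have hn : n ≠ n + 1 := by lia
  let D := double (𝟙 P) (show (ComplexShape.up ℤ).Rel n (n + 1) from rfl)
  let e₀ : D.X n ≅ P := doubleXIso₀ _ _
  let e₁ : D.X (n + 1) ≅ P := doubleXIso₁ _ _ hn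
  have hd : D.d n (n + 1) = e₀.hom ≫ e₁.inv := by
    simpa using double_d (𝟙 P) (show (ComplexShape.up ℤ).Rel n (n + 1) from rfl) hn
  let f (k : ℤ) : K.X k ⟶ D.X k :=
    if h₀ : k = n then (K.XIsoOfEq h₀).hom ≫ φ₀ ≫ e₀.inv ≫ (D.XIsoOfEq h₀).inv
    else if h₁ : k = n + 1 then (K.XIsoOfEq h₁).hom ≫ φ₁ ≫ e₁.inv ≫ (D.XIsoOfEq h₁).inv
    else 0
  have f₀ : f n = φ₀ ≫ e₀.inv := by simp [f]
  have f₁ : f (n + 1) = φ₁ ≫ e₁.inv := by simp [f]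
  refine ⟨{ f := f, comm' := ?_ }, f₀, f₁⟩
  rintro i j rfl
  by_cases h₀ : i = n
  · subst h₀
    change f i ≫ D.d i (i + 1) = K.d i (i + 1) ≫ f (i + 1)
    rw [f₀, f₁, hd, Category.assoc, e₀.inv_hom_id_assoc, reassoc_of% comm]
  · by_cases h₁ : i + 1 = n
    · subst h₁
      rw [f₀, reassoc_of% (h i rfl), zero_comp]
      rw [double_d_eq_zero₀ _ _ _ _ (by omega), comp_zero]
    · exact (isZero_double_X _ _ (i + 1) h₁ (by omega)).eq_of_tgt _ _

/-- The two-term complex `P ⟶ P` given by the identity is a retract of `K` as soon as the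
identity of `P` factors compatibly through `K` in both degrees. -/
lemma nonempty_retract_double_id {P : 𝒜} {n : ℤ} {K : CochainComplex 𝒜 ℤ}
    {a₀ : P ⟶ K.X n} {a₁ : P ⟶ K.X (n + 1)} {b₀ : K.X n ⟶ P} {b₁ : K.X (n + 1) ⟶ P}
    (ha : a₀ ≫ K.d n (n + 1) = a₁) (ha' : a₁ ≫ K.d (n + 1) (n + 1 + 1) = 0)
    (hb : K.d n (n + 1) ≫ b₁ = b₀) (hb' : ∀ i, i + 1 = n → K.d i n ≫ b₀ = 0)
    (h₀ : a₀ ≫ b₀ = 𝟙 P) (h₁ : a₁ ≫ b₁ = 𝟙 P) :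
    Nonempty (Retract (double (𝟙 P)
      (show (ComplexShape.up ℤ).Rel n (n + 1) from rfl)) K) := by
  obtain ⟨r, hr₀, hr₁⟩ := exists_hom_to_double_id b₀ b₁ hb hb'
  refine ⟨⟨mkHomFromDouble _ (by lia) a₀ a₁ (by rw [ha, Category.id_comp]) ?_, r, ?_⟩⟩
  · rintro k rfl
    exact ha'
  · apply from_double_hom_ext
    · simp [hr₀, reassoc_of% h₀]
    · simp [hr₁, reassoc_of% h₁]

variable [HasDerivedCategory.{w} 𝒜]

open DerivedCategory

/-- In a minimal complex of projectives, the lowest term gives a nonzero morphism in the derived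
category: otherwise the identity of this term would factor through the differential. -/
lemma exists_hom_single_ne_zero_of_minimal {K : CochainComplex 𝒜 ℤ} [K.IsKProjective]
    (n : ℤ) [K.IsStrictlyGE n] (hP : ¬ IsZero (K.X n))
    (hK : Nonempty (Retract (double (𝟙 (K.X n))
      (show (ComplexShape.up ℤ).Rel n (n + 1) from rfl)) K) → IsZero (K.X n)) :
    ∃ f : Q.obj K ⟶ (singleFunctor 𝒜 n).obj (K.X n), f ≠ 0 := by
  have hz : IsZero (K.X (n - 1)) := K.isZero_of_isStrictlyGE n _
  let φ : K ⟶ (single 𝒜 (ComplexShape.up ℤ) n).obj (K.X n) :=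
    mkHomToSingle (𝟙 _) fun i hi ↦ by
      obtain rfl : i = n - 1 := by have : i + 1 = n := hi; lia
      exact hz.eq_of_src _ _
  refine ⟨Q.map φ, fun h ↦ hP (hK ?_)⟩
  obtain ⟨h⟩ : Nonempty (Homotopy φ 0) := nonempty_homotopy_zero_of_Q_map_eq_zero h
  have hn := h.comm n
  rw [prevD_eq _ (show (ComplexShape.up ℤ).Rel (n - 1) n by simp),
    dNext_eq _ (show (ComplexShape.up ℤ).Rel n (n + 1) from rfl), single_obj_d, comp_zero,
    mkHomToSingle_f, Category.id_comp, zero_f, add_zero, add_zero] at hn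
  have hs : K.d n (n + 1) ≫ h.hom (n + 1) n ≫
      (singleObjXSelf (ComplexShape.up ℤ) n (K.X n)).hom = 𝟙 _ := by
    rw [← Category.assoc, ← hn, Iso.inv_hom_id]
  exact nonempty_retract_double_id (a₀ := 𝟙 _) (b₀ := 𝟙 _) (Category.id_comp _) (by simp) hs
    (fun i hi ↦ by
      obtain rfl : i = n - 1 := by lia
      exact hz.eq_of_src _ _) (Category.id_comp _) hs

/-- In a minimal complex of projectives, the highest term gives a nonzero morphism in the derived
category: otherwise the differential onto this term would be a split epimorphism. -/
lemma exists_single_hom_ne_zero_of_minimal {K : CochainComplex 𝒜 ℤ}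
    (n : ℤ) [K.IsStrictlyLE (n + 1)] [Projective (K.X (n + 1))] (hP : ¬ IsZero (K.X (n + 1)))
    (hK : Nonempty (Retract (double (𝟙 (K.X (n + 1)))
      (show (ComplexShape.up ℤ).Rel n (n + 1) from rfl)) K) → IsZero (K.X (n + 1))) :
    ∃ f : (singleFunctor 𝒜 (n + 1)).obj (K.X (n + 1)) ⟶ Q.obj K, f ≠ 0 := by
  have hz : IsZero (K.X (n + 1 + 1)) := K.isZero_of_isStrictlyLE (n + 1) _
  have hP' := projective_single_X (K.X (n + 1)) (n + 1)
  have := CochainComplex.isKProjective_of_projective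
    ((single 𝒜 (ComplexShape.up ℤ) (n + 1)).obj (K.X (n + 1))) (n + 1)
  let φ : (single 𝒜 (ComplexShape.up ℤ) (n + 1)).obj (K.X (n + 1)) ⟶ K :=
    mkHomFromSingle (𝟙 _) fun i hi ↦ by
      obtain rfl : n + 1 + 1 = i := hi
      exact hz.eq_of_tgt _ _
  refine ⟨Q.map φ, fun h ↦ hP (hK ?_)⟩
  obtain ⟨h⟩ : Nonempty (Homotopy φ 0) := nonempty_homotopy_zero_of_Q_map_eq_zero h
  have hn := h.comm (n + 1)
  rw [prevD_eq _ (show (ComplexShape.up ℤ).Rel n (n + 1) from rfl),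
    dNext_eq _ (show (ComplexShape.up ℤ).Rel (n + 1) (n + 1 + 1) from rfl), single_obj_d,
    zero_comp, mkHomFromSingle_f, Category.comp_id, zero_f, zero_add, add_zero] at hn
  have hs : ((singleObjXSelf (ComplexShape.up ℤ) (n + 1) (K.X (n + 1))).inv ≫
      h.hom (n + 1) n) ≫ K.d n (n + 1) = 𝟙 _ := by
    rw [Category.assoc, ← hn, Iso.inv_hom_id]
  exact nonempty_retract_double_id (a₁ := 𝟙 _) (b₁ := 𝟙 _) hs
    (hz.eq_of_tgt _ _) (Category.comp_id _) (by simp) hs (Category.id_comp _)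

/-- Removing a contractible direct summand from a complex does not change its image in the
derived category. -/
lemma exists_complement_of_retract {K D : CochainComplex 𝒜 ℤ} (h : Retract D K)
    (hD : IsZero (Q.obj D)) :
    ∃ (L : CochainComplex 𝒜 ℤ) (j : L ⟶ K) (p : K ⟶ L), j ≫ p = 𝟙 L ∧ j ≫ h.r = 0 ∧
      Nonempty (Q.obj K ≅ Q.obj L) := by
  obtain ⟨L, j, p, hjp, hpj⟩ := IsIdempotentComplete.idempotents_split K (𝟙 K - h.r ≫ h.i)
    (by simp [Preadditive.sub_comp, Preadditive.comp_sub])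
  have hj : j = j ≫ p ≫ j := by rw [reassoc_of% hjp]
  refine ⟨L, j, p, hjp, ?_, ⟨⟨Q.map p, Q.map j, ?_, ?_⟩⟩⟩
  · rw [hj, hpj]
    simp [Preadditive.sub_comp, Preadditive.comp_sub]
  · rw [← Functor.map_comp, hpj, Functor.map_sub, CategoryTheory.Functor.map_id, Functor.map_comp,
      hD.eq_of_tgt (Q.map h.r) 0, zero_comp, sub_zero]
  · rw [← Functor.map_comp, hjp, CategoryTheory.Functor.map_id]

end MinimalComplexes

/-! ### Finitely generated modules over artinian rings -/

section FinitelyGeneratedModules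

variable {R : Type u} [Ring R]

lemma FGModuleCat.epi_of_surjective {M N : FGModuleCat.{u} R} (f : M ⟶ N)
    (hf : Function.Surjective f.hom.hom) : Epi f :=
  ⟨fun _ _ h ↦ FGModuleCat.hom_ext (LinearMap.ext fun y ↦ by
    obtain ⟨x, rfl⟩ := hf y
    exact congrArg (fun l ↦ l.hom.hom x) h)⟩

lemma FGModuleCat.mono_of_injective {M N : FGModuleCat.{u} R} (f : M ⟶ N)
    (hf : Function.Injective f.hom.hom) : Mono f :=
  ⟨fun _ _ h ↦ FGModuleCat.hom_ext (LinearMap.ext fun y ↦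
    hf (congrArg (fun l ↦ l.hom.hom y) h))⟩

lemma FGModuleCat.surjective_of_epi {M N : FGModuleCat.{u} R} (f : M ⟶ N) [Epi f] :
    Function.Surjective f.hom.hom := by
  let q : N ⟶ FGModuleCat.of R (N ⧸ LinearMap.range f.hom.hom) :=
    ⟨ModuleCat.ofHom (LinearMap.range f.hom.hom).mkQ⟩
  have hq : q = ⟨ModuleCat.ofHom 0⟩ := by
    rw [← cancel_epi f]
    refine FGModuleCat.hom_ext (LinearMap.ext fun x ↦ ?_)
    exact (Submodule.Quotient.mk_eq_zero _).2 ⟨x, rfl⟩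
  rw [← LinearMap.range_eq_top, eq_top_iff]
  intro y _
  exact (Submodule.Quotient.mk_eq_zero _).1 (congrArg (fun l ↦ l.hom.hom y) hq)

lemma FGModuleCat.projective_of (M : Type u) [AddCommGroup M] [Module R M] [Module.Finite R M]
    [Module.Projective R M] : Projective (FGModuleCat.of R M) where
  factors {E X} f e _ := by
    obtain ⟨h, hh⟩ := Module.projective_lifting_property e.hom.hom f.hom.hom
      (FGModuleCat.surjective_of_epi e)
    exact ⟨⟨ModuleCat.ofHom h⟩, FGModuleCat.hom_ext hh⟩

instance FGModuleCat.enoughProjectives : EnoughProjectives (FGModuleCat.{u} R) where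
  presentation M := by
    obtain ⟨n, f, hf⟩ := Module.Finite.exists_fin' R M
    have := FGModuleCat.projective_of (R := R) (Fin n → R)
    let φ : FGModuleCat.of R (Fin n → R) ⟶ M := ⟨ModuleCat.ofHom f⟩
    exact ⟨{ p := FGModuleCat.of R (Fin n → R), f := φ, epi := FGModuleCat.epi_of_surjective φ hf }⟩

/-- The finitely generated form of the dual basis lemma, for a free module `G` of rank one. -/
lemma FGModuleCat.exists_sum_eq_id [IsNoetherianRing R] {G : Type u} [AddCommGroup G] [Module R G]
    [Module.Finite R G] (e : R ≃ₗ[R] G) (P : FGModuleCat.{u} R) [Projective P] :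
    ∃ (n : ℕ) (a : Fin n → (P ⟶ FGModuleCat.of R G)) (b : Fin n → (FGModuleCat.of R G ⟶ P)),
      ∑ i, a i ≫ b i = 𝟙 P := by
  obtain ⟨n, s, hs⟩ := Module.Finite.exists_fin (R := R) (M := P)
  let b (i : Fin n) : FGModuleCat.of R G ⟶ P :=
    ⟨ModuleCat.ofHom (LinearMap.toSpanSingleton R P (s i) ∘ₗ e.symm.toLinearMap)⟩
  let π : FGModuleCat.of R (Fin n → G) ⟶ P :=
    ⟨ModuleCat.ofHom (∑ i, (b i).hom.hom ∘ₗ LinearMap.proj i)⟩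
  have hπ : Function.Surjective π.hom.hom := by
    rw [← LinearMap.range_eq_top, eq_top_iff, ← hs, Submodule.span_le]
    rintro _ ⟨i, rfl⟩
    refine ⟨Pi.single i (e 1), ?_⟩
    change (∑ i, (b i).hom.hom ∘ₗ LinearMap.proj i : (Fin n → G) →ₗ[R] P) _ = _
    rw [LinearMap.sum_apply, Finset.sum_eq_single i]
    · simp [b]
    · intro j _ hj
      simp [hj]
    · simp
  have := FGModuleCat.epi_of_surjective π hπ
  let σ := Projective.factorThru (𝟙 P) π
  refine ⟨n, fun i ↦ σ ≫ ⟨ModuleCat.ofHom (LinearMap.proj i)⟩, b, ?_⟩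
  have h : π = ∑ i, (⟨ModuleCat.ofHom (LinearMap.proj i)⟩ :
      FGModuleCat.of R (Fin n → G) ⟶ FGModuleCat.of R G) ≫ b i := by
    refine FGModuleCat.hom_ext ?_
    have h' := (ModuleCat.isFG R).ι.map_sum (fun i : Fin n ↦
      (⟨ModuleCat.ofHom (LinearMap.proj i)⟩ :
        FGModuleCat.of R (Fin n → G) ⟶ FGModuleCat.of R G) ≫ b i) Finset.univ
    have h'' := congrArg ModuleCat.Hom.hom h'
    rw [ModuleCat.hom_sum] at h''
    exact h''.symm
  simp_rw [Category.assoc]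
  rw [← Preadditive.comp_sum, ← h, Projective.factorThru_comp]

/-- The quotient of an artinian ring by its Jacobson radical is a semisimple module. -/
lemma isSemisimpleModule_quotient_jacobson [IsArtinianRing R] :
    IsSemisimpleModule R (R ⧸ Ring.jacobson R) := by
  let f : (R ⧸ Ring.jacobson R) →ₛₗ[Ideal.Quotient.mk (Ring.jacobson R)] (R ⧸ Ring.jacobson R) :=
    { toFun := id, map_add' := fun _ _ ↦ rfl
      map_smul' := fun r x ↦ by
        obtain ⟨x, rfl⟩ := Ideal.Quotient.mk_surjective x
        rfl }
  have : RingHomSurjective (Ideal.Quotient.mk (Ring.jacobson R)) :=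
    ⟨Ideal.Quotient.mk_surjective⟩
  exact (f.isSemisimpleModule_iff_of_bijective Function.bijective_id).2 inferInstance

lemma exists_retract_quotient_jacobson [IsArtinianRing R] (S : Type u) [AddCommGroup S]
    [Module R S] [IsSimpleModule R S] [Module.Finite R S] :
    Nonempty (Retract (FGModuleCat.of R S) (FGModuleCat.of R (R ⧸ Ring.jacobson R))) := by
  have := isSemisimpleModule_quotient_jacobson (R := R)
  have := IsSimpleModule.nontrivial R S
  obtain ⟨x, hx⟩ := exists_ne (0 : S)
  let f : (R ⧸ Ring.jacobson R) →ₗ[R] S := (Ring.jacobson R).liftQ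
    (LinearMap.toSpanSingleton R S x) fun r hr ↦
      Module.mem_annihilator.1 (IsSemisimpleModule.jacobson_le_annihilator R S hr) x
  have hf : Function.Surjective f := fun y ↦ by
    obtain ⟨r, rfl⟩ := IsSimpleModule.toSpanSingleton_surjective R hx y
    exact ⟨Submodule.Quotient.mk r, rfl⟩
  obtain ⟨g, hg⟩ := IsSemisimpleModule.lifting_property f hf LinearMap.id
  exact ⟨⟨FGModuleCat.ofHom g, FGModuleCat.ofHom f, FGModuleCat.hom_ext hg⟩⟩

/-- A property of finitely generated modules over an artinian ring which is stable under
extensions and retracts holds as soon as it holds for the quotient by the Jacobson radical. -/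
lemma FGModuleCat.induction_of_jacobson [IsArtinianRing R] (p : FGModuleCat.{u} R → Prop)
    (hext : ∀ S : ShortComplex (FGModuleCat.{u} R), S.ShortExact → p S.X₁ → p S.X₃ → p S.X₂)
    (hret : ∀ {M N : FGModuleCat.{u} R}, Retract M N → p N → p M)
    (hJ : p (FGModuleCat.of R (R ⧸ Ring.jacobson R))) (M : FGModuleCat.{u} R) : p M := by
  suffices ∀ {M : Type u} [AddCommGroup M] [Module R M] (_ : IsFiniteLength R M)
      [Module.Finite R M], p (FGModuleCat.of R M) from
    this (isFiniteLength_iff_isNoetherian_isArtinian.2 ⟨inferInstance, inferInstance⟩)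
  intro M _ _ hM
  induction hM with
  | @of_subsingleton M _ _ _ =>
    intro _
    exact hret (IsZero.retract _ ⟨fun Y ↦ ⟨⟨⟨FGModuleCat.ofHom 0⟩, fun f ↦ FGModuleCat.hom_ext
      (LinearMap.ext fun x ↦ by rw [Subsingleton.elim x 0, map_zero, map_zero])⟩⟩,
      fun Y ↦ ⟨⟨⟨FGModuleCat.ofHom 0⟩, fun f ↦ FGModuleCat.hom_ext
      (LinearMap.ext fun x ↦ Subsingleton.elim (α := M) _ _)⟩⟩⟩) hJ
  | @of_simple_quotient M _ _ N _ _ ih =>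
    intro _
    let f : FGModuleCat.of R N ⟶ FGModuleCat.of R M := FGModuleCat.ofHom N.subtype
    let g : FGModuleCat.of R M ⟶ FGModuleCat.of R (M ⧸ N) := FGModuleCat.ofHom N.mkQ
    have hfg : f ≫ g = 0 := FGModuleCat.hom_ext (LinearMap.ext fun x ↦
      (Submodule.Quotient.mk_eq_zero _).2 x.2)
    have hf : Mono f := FGModuleCat.mono_of_injective f N.subtype_injective
    have hg : Epi g := FGModuleCat.epi_of_surjective g N.mkQ_surjective
    refine hext (ShortComplex.mk f g hfg) { exact := ?_ } ih ?_
    · refine ShortComplex.exact_of_f_is_kernel _ (KernelFork.IsLimit.ofι' f hfg fun {W} h hh ↦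
        ⟨⟨ModuleCat.ofHom (h.hom.hom.codRestrict N fun x ↦ ?_)⟩, rfl⟩)
      exact (Submodule.Quotient.mk_eq_zero _).1 (congrArg (fun l ↦ l.hom.hom x) hh)
    · obtain ⟨r⟩ := exists_retract_quotient_jacobson (R := R) (M ⧸ N)
      exact hret r hJ

lemma FGModuleCat.injective_of_retract {M N : FGModuleCat.{u} R} (r : Retract M N) :
    Function.Injective r.i.hom.hom :=
  Function.LeftInverse.injective (g := r.r.hom.hom) fun x ↦
    congrArg (fun l ↦ l.hom.hom x) r.retract

lemma FGModuleCat.length_lt_of_retract [IsArtinianRing R] {M N D : FGModuleCat.{u} R}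
    (r : Retract M N) (q : N ⟶ D) (hq : q ≠ ⟨ModuleCat.ofHom 0⟩)
    (h : r.i ≫ q = ⟨ModuleCat.ofHom 0⟩) : Module.length R M < Module.length R N := by
  rw [(LinearEquiv.ofInjective _ (FGModuleCat.injective_of_retract r)).length_eq]
  refine Submodule.length_lt fun htop ↦ hq ?_
  refine FGModuleCat.hom_ext (LinearMap.ext fun y ↦ ?_)
  obtain ⟨x, rfl⟩ := LinearMap.range_eq_top.1 htop y
  exact congrArg (fun l ↦ l.hom.hom x) h

end FinitelyGeneratedModules

/-! ### Perfect objects of the bounded derived category -/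

section BoundedDerivedCategory

variable {k : Type v} [Field k] {A : Type u} [Ring A] [Algebra k A] [Module.Finite k A]

instance FDMod.enoughProjectives : EnoughProjectives (FDMod k A) :=
  inferInstanceAs (EnoughProjectives (FGModuleCat.{u} Aᵐᵒᵖ))

/-- The identification of the two right modules `Aᵐᵒᵖ` and `A`. -/
def mulOppositeLinearEquiv (A : Type u) [Ring A] : Aᵐᵒᵖ ≃ₗ[Aᵐᵒᵖ] A where
  toFun := MulOpposite.unop
  invFun := MulOpposite.op
  map_add' _ _ := rfl
  map_smul' _ _ := rfl
  left_inv _ := rfl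
  right_inv _ := rfl

/-- The finite form of the dual basis lemma. -/
lemma exists_sum_regularModule_eq_id (P : FDMod k A) [hP : Projective P] :
    ∃ (n : ℕ) (a : Fin n → (P ⟶ regularModule k A)) (b : Fin n → (regularModule k A ⟶ P)),
      ∑ i, a i ≫ b i = 𝟙 P :=
  haveI := isNoetherianRing_mulOpposite_of_finite k A
  haveI : Projective (C := FGModuleCat.{u} Aᵐᵒᵖ) P := hP
  FGModuleCat.exists_sum_eq_id (R := Aᵐᵒᵖ) (mulOppositeLinearEquiv A) P

open DerivedCategory

lemma exists_hom_regularModule_ne_zero {X : DerivedCategory (FDMod k A)} {n : ℤ} {P : FDMod k A}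
    [Projective P] {f : X ⟶ (singleFunctor _ n).obj P} (hf : f ≠ 0) :
    ∃ g : X ⟶ (singleFunctor _ n).obj (regularModule k A), g ≠ 0 := by
  by_contra! H
  obtain ⟨m, a, b, h⟩ := exists_sum_regularModule_eq_id P
  apply hf
  rw [← Category.comp_id f, ← CategoryTheory.Functor.map_id, ← h, Functor.map_sum,
    Preadditive.comp_sum]
  refine Finset.sum_eq_zero fun i _ ↦ ?_
  rw [Functor.map_comp, ← Category.assoc, H (f ≫ (singleFunctor _ n).map (a i)), zero_comp]

lemma exists_regularModule_hom_ne_zero {X : DerivedCategory (FDMod k A)} {n : ℤ} {P : FDMod k A}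
    [Projective P] {f : (singleFunctor _ n).obj P ⟶ X} (hf : f ≠ 0) :
    ∃ g : (singleFunctor _ n).obj (regularModule k A) ⟶ X, g ≠ 0 := by
  by_contra! H
  obtain ⟨m, a, b, h⟩ := exists_sum_regularModule_eq_id P
  apply hf
  rw [← Category.id_comp f, ← CategoryTheory.Functor.map_id, ← h, Functor.map_sum,
    Preadditive.sum_comp]
  refine Finset.sum_eq_zero fun i _ ↦ ?_
  rw [Functor.map_comp, Category.assoc, H ((singleFunctor _ n).map (b i) ≫ f), comp_zero]

/-- The semisimple right module `A / rad A`. -/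
def semisimpleQuotient (k : Type v) [Field k] (A : Type u) [Ring A] [Algebra k A]
    [Module.Finite k A] : FDMod k A :=
  FGModuleCat.of Aᵐᵒᵖ (Aᵐᵒᵖ ⧸ Ring.jacobson Aᵐᵒᵖ)

/-- Perfectness is detected by the morphisms to the shifts of `A / rad A`. -/
lemma isPerf_of_hom_semisimpleQuotient_eq_zero {X : DerivedCategory (FDMod k A)} (a b : ℤ)
    [X.IsGE a] [X.IsLE b]
    (h : ∀ f : X ⟶ (singleFunctor _ (a - 1)).obj (semisimpleQuotient k A), f = 0) : IsPerf X := by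
  have hb : X.IsLE (a + (b - a).toNat) := TStructure.t.isLE_of_le X b _ (by lia)
  refine isPerf_of_hom_single_eq_zero a (b - a).toNat X fun N ↦ ?_
  have : IsArtinianRing Aᵐᵒᵖ := IsArtinianRing.of_finite k Aᵐᵒᵖ
  refine FGModuleCat.induction_of_jacobson (R := Aᵐᵒᵖ)
    (fun N ↦ ∀ f : X ⟶ (singleFunctor (FDMod k A) (a - 1)).obj N, f = 0)
    (fun S hS h₁ h₃ ↦
      hom_single_eq_zero_of_shortExact X (a - 1) (𝒜 := FDMod k A) (S := S) hS h₁ h₃)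
    (fun {M N} r hN f ↦ ?_) h N
  let r' : Retract ((singleFunctor (FDMod k A) (a - 1)).obj M)
    ((singleFunctor (FDMod k A) (a - 1)).obj N) := Retract.map (C := FDMod k A) r _
  rw [← Category.comp_id f, ← r'.retract, ← Category.assoc, hN (f ≫ r'.i), zero_comp]

lemma isPerfect_iff (X : Db k A) : IsPerfect X ↔ IsPerf X.obj :=
  ⟨fun ⟨K, h⟩ ↦ ⟨K, h.bounded_below, h.bounded_above, h.projective, h.iso⟩,
    fun ⟨K, h₁, h₂, h₃, h₄⟩ ↦ ⟨K, h₁, h₂, h₃, h₄⟩⟩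

/-- The regular module is projective. -/
lemma projective_regularModule (k : Type v) [Field k] (A : Type u) [Ring A] [Algebra k A]
    [Module.Finite k A] : Projective (regularModule k A) :=
  haveI : Module.Projective Aᵐᵒᵖ A := Module.Projective.of_equiv (mulOppositeLinearEquiv A)
  FGModuleCat.projective_of (R := Aᵐᵒᵖ) A

lemma isPerfect_regularObject (k : Type v) [Field k] (A : Type u) [Ring A] [Algebra k A]
    [Module.Finite k A] : IsPerfect (regularObject k A) :=
  haveI := projective_regularModule k A
  (isPerfect_iff _).2 (isPerf_single (regularModule k A) 0)

lemma IsProjRep.isKProjective {K : CochainComplex (FDMod k A) ℤ} {X : Db k A}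
    (h : IsProjRep K X) : K.IsKProjective := by
  obtain ⟨b, _⟩ := h.bounded_above
  have := h.projective
  exact CochainComplex.isKProjective_of_projective K b

/-- The inclusion of `D^b(mod-A)` commutes with shifts. -/
noncomputable def Db.shiftObjIso (X : Db k A) (n : ℤ) : (X⟦n⟧).obj ≅ X.obj⟦n⟧ :=
  ((Bounded.ι (C := FDMod k A)).commShiftIso n).app X

lemma Db.exists_hom_ne_zero {X Y : Db k A} {X' Y' : DerivedCategory (FDMod k A)}
    (e : X.obj ≅ X') (e' : Y.obj ≅ Y') {g : X' ⟶ Y'} (hg : g ≠ 0) : ∃ f : X ⟶ Y, f ≠ 0 := by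
  refine ⟨⟨e.hom ≫ g ≫ e'.inv⟩, fun h ↦ hg ?_⟩
  have h' : e.hom ≫ g ≫ e'.inv = 0 := congrArg (fun l ↦ l.hom) h
  rwa [← comp_zero (f := e.hom), cancel_epi, ← zero_comp (f := e'.inv), cancel_mono] at h'

/-- A nonzero morphism to a shift forces the supports of representing complexes to meet, after the
corresponding shift of degrees. -/
lemma IsProjRep.exists_not_isZero {X Y : Db k A} {K L : CochainComplex (FDMod k A) ℤ}
    (hK : IsProjRep K X) (e : Y.obj ≅ Q.obj L) {n : ℤ} {f : X ⟶ Y⟦n⟧} (hf : f ≠ 0) :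
    ∃ i, ¬ IsZero (K.X i) ∧ ¬ IsZero (L.X (i + n)) := by
  have := hK.isKProjective
  obtain ⟨eX⟩ := hK.iso
  refine exists_not_isZero_of_ne_zero eX e (f := f.hom ≫ (Db.shiftObjIso Y n).hom) fun h ↦ hf ?_
  rw [← zero_comp (f := (Db.shiftObjIso Y n).hom), cancel_mono] at h
  exact ObjectProperty.hom_ext _ h

/-- The lowest degree of a minimal representative is seen by morphisms to the regular module. -/
lemma IsMinimalProjRep.exists_hom_ne_zero {X : Db k A} {K : CochainComplex (FDMod k A) ℤ}
    (hK : IsMinimalProjRep K X) (n : ℤ) [K.IsStrictlyGE n] (hn : ¬ IsZero (K.X n)) :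
    ∃ f : X ⟶ (regularObject k A)⟦-n⟧, f ≠ 0 := by
  have := hK.isKProjective
  have hP := hK.projective n
  obtain ⟨f, hf⟩ := exists_hom_single_ne_zero_of_minimal n hn (hK.isZero_of_retract n _ hP)
  obtain ⟨g, hg⟩ := exists_hom_regularModule_ne_zero hf
  obtain ⟨e⟩ := hK.iso
  exact Db.exists_hom_ne_zero e (Db.shiftObjIso (regularObject k A) (-n) ≪≫
    ((singleFunctors (FDMod k A)).shiftIso (-n) n 0 (by lia)).app (regularModule k A)) hg

/-- The highest degree of a minimal representative is seen by morphisms from the regular module. -/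
lemma IsMinimalProjRep.exists_ne_zero_hom {X : Db k A} {K : CochainComplex (FDMod k A) ℤ}
    (hK : IsMinimalProjRep K X) (n : ℤ) [hle : K.IsStrictlyLE n] (hn : ¬ IsZero (K.X n)) :
    ∃ f : regularObject k A ⟶ X⟦n⟧, f ≠ 0 := by
  have hP := hK.projective n
  obtain ⟨f, hf⟩ : ∃ f : (singleFunctor _ n).obj (K.X n) ⟶ Q.obj K, f ≠ 0 := by
    obtain ⟨m, rfl⟩ : ∃ m, n = m + 1 := ⟨n - 1, by lia⟩
    exact exists_single_hom_ne_zero_of_minimal m hn (hK.isZero_of_retract m _ hP)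
  obtain ⟨g, hg⟩ := exists_regularModule_hom_ne_zero hf
  obtain ⟨e⟩ := hK.iso
  refine Db.exists_hom_ne_zero (X := regularObject k A)
    (((singleFunctors (FDMod k A)).shiftIso n 0 n (by lia)).app (regularModule k A)).symm
    (Db.shiftObjIso X n ≪≫ (shiftFunctor _ n).mapIso e) (g := g⟦n⟧') fun h ↦ hg ?_
  apply (shiftFunctor (DerivedCategory (FDMod k A)) n).map_injective
  rw [Functor.map_zero]
  exact h

end BoundedDerivedCategory

/-! ### Composition length and minimal representatives -/

section Length

variable {k : Type v} [Field k] {A : Type u} [Ring A] [Algebra k A] [Module.Finite k A]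

open DerivedCategory

/-- The composition length of a finite dimensional module, as a natural number; no value is lost
since this length is finite. -/
noncomputable def FDMod.length (M : FDMod k A) : ℕ :=
  (Module.length Aᵐᵒᵖ (FGModuleCat.carrier (R := Aᵐᵒᵖ) M)).toNat

lemma FDMod.length_ne_top (M : FDMod k A) :
    Module.length Aᵐᵒᵖ (FGModuleCat.carrier (R := Aᵐᵒᵖ) M) ≠ ⊤ :=
  haveI : IsArtinianRing Aᵐᵒᵖ := IsArtinianRing.of_finite k Aᵐᵒᵖ
  haveI : Module.Finite Aᵐᵒᵖ (FGModuleCat.carrier (R := Aᵐᵒᵖ) M) := M.property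
  Module.length_ne_top

lemma FDMod.length_le_of_retract {M N : FDMod k A} (r : Retract M N) : M.length ≤ N.length :=
  ENat.toNat_le_toNat (Module.length_le_of_injective _
    (FGModuleCat.injective_of_retract (R := Aᵐᵒᵖ) ⟨r.i, r.r, r.retract⟩)) N.length_ne_top

lemma FDMod.length_lt_of_retract {M N D : FDMod k A} (r : Retract M N) (q : N ⟶ D)
    (hq : q ≠ 0) (h : r.i ≫ q = 0) : M.length < N.length := by
  have : IsArtinianRing Aᵐᵒᵖ := IsArtinianRing.of_finite k Aᵐᵒᵖ
  have h' := FGModuleCat.length_lt_of_retract (R := Aᵐᵒᵖ) ⟨r.i, r.r, r.retract⟩ q hq h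
  rw [← ENat.natCast_toNat M.length_ne_top, ← ENat.natCast_toNat N.length_ne_top] at h'
  exact_mod_cast h'

/-- Minimal representatives exist: a representative whose terms have the least possible total
composition length cannot have a contractible direct summand. -/
lemma IsPerfect.exists_isMinimalProjRep {X : Db k A} (hX : IsPerfect X) :
    ∃ K : CochainComplex (FDMod k A) ℤ, IsMinimalProjRep K X := by
  obtain ⟨K₀, hK₀⟩ := hX
  obtain ⟨a, _⟩ := hK₀.bounded_below
  obtain ⟨b, _⟩ := hK₀.bounded_above
  let p (N : ℕ) : Prop := ∃ K : CochainComplex (FDMod k A) ℤ, IsProjRep K X ∧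
    K.IsStrictlyGE a ∧ K.IsStrictlyLE b ∧ ∑ i ∈ Finset.Icc a b, (K.X i).length = N
  have hp : ∃ N, p N := ⟨_, K₀, hK₀, inferInstance, inferInstance, rfl⟩
  classical
  obtain ⟨K, hK, _, _, hN⟩ := Nat.find_spec hp
  refine ⟨K, { toIsProjRep := hK, isZero_of_retract := fun n P _ ⟨r⟩ ↦ ?_ }⟩
  obtain ⟨L, j, q, hjq, hjr, ⟨e⟩⟩ := exists_complement_of_retract r (isZero_Q_double_id P n)
  let s (i : ℤ) : Retract (L.X i) (K.X i) :=
    Retract.map ⟨j, q, hjq⟩ (HomologicalComplex.eval _ _ i)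
  have hLa : L.IsStrictlyGE a := (CochainComplex.isStrictlyGE_iff _ _).2 fun i hi ↦
    (K.isZero_of_isStrictlyGE a i).of_mono (s i).i
  have hLb : L.IsStrictlyLE b := (CochainComplex.isStrictlyLE_iff _ _).2 fun i hi ↦
    (K.isZero_of_isStrictlyLE b i).of_mono (s i).i
  have hL : IsProjRep L X :=
    { bounded_below := ⟨a, hLa⟩
      bounded_above := ⟨b, hLb⟩
      projective := fun i ↦ have := hK.projective i; (s i).projective
      iso := ⟨hK.iso.some ≪≫ e⟩ }
  by_contra hP
  let x : (HomologicalComplex.double (𝟙 P)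
    (show (ComplexShape.up ℤ).Rel n (n + 1) from rfl)).X n ≅ P := HomologicalComplex.doubleXIso₀ _ _
  have hr : r.r.f n ≠ 0 := fun h ↦ hP <| by
    refine IsZero.of_iso ((IsZero.iff_id_eq_zero _).2 ?_) x.symm
    rw [← HomologicalComplex.id_f, ← r.retract, HomologicalComplex.comp_f, h, comp_zero]
  have hn : n ∈ Finset.Icc a b := by
    rw [Finset.mem_Icc]
    constructor <;> by_contra! h <;> apply hr
    · exact (K.isZero_of_isStrictlyGE a n).eq_of_src _ _
    · exact (K.isZero_of_isStrictlyLE b n).eq_of_src _ _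
  refine Nat.find_min hp (m := ∑ i ∈ Finset.Icc a b, (L.X i).length) ?_
    ⟨L, hL, hLa, hLb, rfl⟩
  rw [← hN]
  exact Finset.sum_lt_sum (fun i _ ↦ FDMod.length_le_of_retract (s i))
    ⟨n, hn, FDMod.length_lt_of_retract (s n) (r.r.f n) hr
      (congrArg (fun l ↦ HomologicalComplex.Hom.f l n) hjr)⟩

lemma complexLength_lt_top {K : CochainComplex (FDMod k A) ℤ} {X : Db k A}
    (hK : IsProjRep K X) : complexLength K < ⊤ := by
  obtain ⟨a, _⟩ := hK.bounded_below
  obtain ⟨b, _⟩ := hK.bounded_above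
  refine lt_of_le_of_lt ?_ (ENat.natCast_lt_top (b - a).toNat)
  refine iSup₂_le fun i j ↦ iSup₂_le fun hi hj ↦ ?_
  have hi' : a ≤ i := by
    by_contra! h
    exact hi (K.isZero_of_isStrictlyGE a i)
  have hj' : j ≤ b := by
    by_contra! h
    exact hj (K.isZero_of_isStrictlyLE b j)
  exact_mod_cast Int.toNat_le_toNat (by lia)

lemma le_complexLength {K : CochainComplex (FDMod k A) ℤ} {i j : ℤ}
    (hi : ¬ IsZero (K.X i)) (hj : ¬ IsZero (K.X j)) : ((j - i).toNat : ℕ∞) ≤ complexLength K :=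
  le_iSup₂_of_le i j (le_iSup₂_of_le hi hj le_rfl)

lemma IsPerfect.exists_isMinimalProjRep_complexLength_eq {X : Db k A} (hX : IsPerfect X) :
    ∃ K : CochainComplex (FDMod k A) ℤ, IsMinimalProjRep K X ∧ complexLength K = objLength X := by
  obtain ⟨K₀, hK₀⟩ := hX.exists_isMinimalProjRep
  have : Nonempty {K : CochainComplex (FDMod k A) ℤ // IsMinimalProjRep K X} := ⟨⟨K₀, hK₀⟩⟩
  obtain ⟨K, hK⟩ := ciInf_mem
    (fun K : {K : CochainComplex (FDMod k A) ℤ // IsMinimalProjRep K X} ↦ complexLength K.1)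
  exact ⟨K.1, K.2, hK.trans (iInf_subtype (f := fun K ↦ complexLength K.1))⟩

lemma IsPerfect.objLength_lt_top {X : Db k A} (hX : IsPerfect X) : objLength X < ⊤ := by
  obtain ⟨K, hK, h⟩ := hX.exists_isMinimalProjRep_complexLength_eq
  exact h ▸ complexLength_lt_top hK.toIsProjRep

end Length

/-! ### Fully faithful functors with a right adjoint -/

section FullyFaithfulFunctors

/-- A fully faithful left adjoint preserves indecomposability: its essential image consists of the
objects at which the counit is invertible, hence is closed under direct summands. -/
lemma CategoryTheory.Indecomposable.map_of_adjunction {𝒞 : Type u₁} {𝒟 : Type u₂}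
    [Category.{v₁} 𝒞] [Category.{v₂} 𝒟] [Preadditive 𝒞] [Preadditive 𝒟]
    [HasBinaryBiproducts 𝒞] [HasBinaryBiproducts 𝒟] {F : 𝒞 ⥤ 𝒟} {G : 𝒟 ⥤ 𝒞} (adj : F ⊣ G)
    [F.Full] [F.Faithful] [F.Additive] {X : 𝒞} (hX : Indecomposable X) :
    Indecomposable (F.obj X) := by
  have hF := Functor.FullyFaithful.ofFullyFaithful F
  refine ⟨fun h ↦ hX.1 ?_, fun U V e ↦ ?_⟩
  · rw [IsZero.iff_id_eq_zero] at h ⊢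
    exact F.map_injective (by rw [F.map_id, h, F.map_zero])
  · have hiso : IsIso (adj.counit.app (F.obj X)) :=
      IsIso.of_isIso_fac_left (adj.left_triangle_components X)
    have hU {U : 𝒟} (r : Retract U (F.obj X)) : IsIso (adj.counit.app U) :=
      (MorphismProperty.isomorphisms 𝒟).of_retract
        (NatTrans.retractArrowApp adj.counit r) hiso
    have hU₁ : IsIso (adj.counit.app U) := hU ⟨biprod.inl ≫ e.inv, e.hom ≫ biprod.fst, by simp⟩
    have hV₁ : IsIso (adj.counit.app V) := hU ⟨biprod.inr ≫ e.inv, e.hom ≫ biprod.snd, by simp⟩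
    have := preservesBinaryBiproducts_of_preservesBiproducts F
    let eU : F.obj (G.obj U) ≅ U := asIso (adj.counit.app U)
    let eV : F.obj (G.obj V) ≅ V := asIso (adj.counit.app V)
    have e' : F.obj X ≅ F.obj (G.obj U ⊞ G.obj V) :=
      e ≪≫ biprod.mapIso eU.symm eV.symm ≪≫ (F.mapBiprod _ _).symm
    exact (hX.2 _ _ (hF.preimageIso e')).imp (fun h ↦ (F.map_isZero h).of_iso eU.symm)
      (fun h ↦ (F.map_isZero h).of_iso eV.symm)

open DerivedCategory

variable {k : Type v} [Field k] {A : Type u₁} [Ring A] [Algebra k A] [Module.Finite k A]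
  {B : Type u₂} [Ring B] [Algebra k B] [Module.Finite k B]
  {F : Db k B ⥤ Db k A}

/-- A functor with a right adjoint preserves perfect objects: by adjunction, `F X` has no nonzero
morphisms to high shifts of the module `A / rad A`. -/
lemma IsPerfect.map_of_adjunction {G : Db k A ⥤ Db k B} [G.CommShift ℤ] (adj : F ⊣ G)
    {X : Db k B} (hX : IsPerfect X) : IsPerfect (F.obj X) := by
  obtain ⟨K, hK⟩ := hX
  obtain ⟨c, _⟩ := hK.bounded_below
  let Z : Db k A := ⟨(singleFunctor (FDMod k A) 0).obj (semisimpleQuotient k A),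
    ⟨0, inferInstance⟩, ⟨0, inferInstance⟩⟩
  obtain ⟨⟨a₀, _⟩, ⟨b₀, _⟩⟩ := (F.obj X).property
  obtain ⟨q, _⟩ := (G.obj Z).property.2
  obtain ⟨L, _, ⟨e⟩⟩ := exists_iso_Q_obj_of_isLE (G.obj Z).obj q
  have h₁ (m : ℤ) (hm : q - c < m) (f : X ⟶ (G.obj Z)⟦m⟧) : f = 0 := by
    by_contra hf
    obtain ⟨i, hi, hi'⟩ := hK.exists_not_isZero e hf
    have : c ≤ i := by
      by_contra! h
      exact hi (K.isZero_of_isStrictlyGE c i)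
    exact hi' (L.isZero_of_isStrictlyLE q _)
  -- `a` is a lower bound for the cohomology of `F X` such that `1 - a > q - c`.
  let a := min a₀ (c - q)
  have ha : (F.obj X).obj.IsGE a := TStructure.t.isGE_of_ge _ a a₀
  rw [isPerfect_iff]
  refine isPerf_of_hom_semisimpleQuotient_eq_zero a b₀ fun f ↦ ?_
  by_contra hf
  obtain ⟨g, hg⟩ := Db.exists_hom_ne_zero (X := F.obj X) (Y := Z⟦1 - a⟧) (Iso.refl _)
    (Db.shiftObjIso Z (1 - a) ≪≫ ((singleFunctors (FDMod k A)).shiftIso (1 - a) (a - 1) 0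
      (by lia)).app (semisimpleQuotient k A)) hf
  apply hg
  let c' := (G.commShiftIso (1 - a)).app Z
  have h₂ (g : F.obj X ⟶ Z⟦1 - a⟧) : adj.homEquiv _ _ g ≫ c'.hom = 0 := h₁ _ (by lia) _
  exact (adj.homEquiv _ _).injective ((cancel_mono c'.hom).1 ((h₂ g).trans (h₂ 0).symm))

/-- The length of a minimal complex is bounded by the lengths of any representatives by projectives
of the images of `X` and of the regular module. -/
lemma complexLength_le_add_of_faithful [F.CommShift ℤ] [F.Faithful] [F.Additive] {X : Db k B}
    {K : CochainComplex (FDMod k B) ℤ} (hK : IsMinimalProjRep K X)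
    {K' L : CochainComplex (FDMod k A) ℤ} (hK' : IsProjRep K' (F.obj X))
    (hL : IsProjRep L (F.obj (regularObject k B))) :
    complexLength K ≤ complexLength K' + complexLength L := by
  refine iSup₂_le fun i j ↦ iSup₂_le fun hi hj ↦ ?_
  obtain ⟨a, _⟩ := hK.bounded_below
  obtain ⟨b, _⟩ := hK.bounded_above
  obtain ⟨i₀, hi₀, hmin⟩ := Int.exists_least_of_bdd (P := fun n ↦ ¬ IsZero (K.X n))
    ⟨a, fun z hz ↦ by
      by_contra! h
      exact hz (K.isZero_of_isStrictlyGE a z)⟩ ⟨i, hi⟩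
  obtain ⟨j₀, hj₀, hmax⟩ := Int.exists_greatest_of_bdd (P := fun n ↦ ¬ IsZero (K.X n))
    ⟨b, fun z hz ↦ by
      by_contra! h
      exact hz (K.isZero_of_isStrictlyLE b z)⟩ ⟨j, hj⟩
  have : K.IsStrictlyGE i₀ := (CochainComplex.isStrictlyGE_iff _ _).2 fun n hn ↦ by
    by_contra h
    exact absurd (hmin n h) (by lia)
  have : K.IsStrictlyLE j₀ := (CochainComplex.isStrictlyLE_iff _ _).2 fun n hn ↦ by
    by_contra h
    exact absurd (hmax n h) (by lia)
  have key {Y Z : Db k B} {n : ℤ} {f : Y ⟶ Z⟦n⟧} (hf : f ≠ 0) :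
      ∃ g : F.obj Y ⟶ (F.obj Z)⟦n⟧, g ≠ 0 := by
    let c := (F.commShiftIso n).app Z
    refine ⟨F.map f ≫ c.hom, fun h ↦ hf (F.map_injective ?_)⟩
    rw [← zero_comp (f := c.hom), cancel_mono] at h
    rw [h, F.map_zero]
  obtain ⟨f, hf⟩ := hK.exists_hom_ne_zero i₀ hi₀
  obtain ⟨g, hg⟩ := hK.exists_ne_zero_hom j₀ hj₀
  obtain ⟨f', hf'⟩ := key hf
  obtain ⟨g', hg'⟩ := key hg
  obtain ⟨p, hp, hp'⟩ := hK'.exists_not_isZero hL.iso.some hf'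
  obtain ⟨q, hq, hq'⟩ := hL.exists_not_isZero hK'.iso.some hg'
  have hi' := hmin i hi
  have hj' := hmax j hj
  refine le_trans ?_ (add_le_add (le_complexLength hp hq') (le_complexLength hq hp'))
  norm_cast
  lia

/-- The comparison of strong global dimensions along a fully faithful functor with a right
adjoint. -/
theorem strongGlobalDim_le_of_adjunction {G : Db k A ⥤ Db k B} [G.CommShift ℤ] (adj : F ⊣ G)
    [F.CommShift ℤ] [F.Full] [F.Faithful] [F.Additive] :
    strongGlobalDim k B ≤ strongGlobalDim k A + objLength (F.obj (regularObject k B)) := by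
  have hB := isPerfect_regularObject k B
  refine iSup_le fun X ↦ iSup₂_le fun hX hX' ↦ ?_
  obtain ⟨K, hK⟩ := hX.exists_isMinimalProjRep
  obtain ⟨K', hK', h'⟩ :=
    (hX.map_of_adjunction adj).exists_isMinimalProjRep_complexLength_eq
  obtain ⟨L, hL, h⟩ := (hB.map_of_adjunction adj).exists_isMinimalProjRep_complexLength_eq
  calc objLength X ≤ complexLength K := iInf₂_le K hK
    _ ≤ complexLength K' + complexLength L :=
      complexLength_le_add_of_faithful hK hK'.toIsProjRep hL.toIsProjRep
    _ ≤ _ := by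
      rw [h', h]
      refine add_le_add_left ?_ _
      exact le_iSup_of_le (F.obj X) (le_iSup_of_le (hX.map_of_adjunction adj)
        (le_iSup_of_le (hX'.map_of_adjunction adj) le_rfl))

end FullyFaithfulFunctors

theorem mainTheorem7 {k : Type v} [Field k]
    {A : Type u₁} [Ring A] [Algebra k A] [Module.Finite k A]
    {B : Type u₂} [Ring B] [Algebra k B] [Module.Finite k B]
    {C : Type u₃} [Ring C] [Algebra k C] [Module.Finite k C]
    (R : Recollement (Db k B) (Db k A) (Db k C)) :
    (strongGlobalDim k A < ⊤ → strongGlobalDim k B < ⊤ ∧ strongGlobalDim k C < ⊤) ∧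
      IsPerfect (R.iPush.obj (regularObject k B)) ∧
      strongGlobalDim k B ≤
        strongGlobalDim k A + objLength (R.iPush.obj (regularObject k B)) := by
  let := R.iPush_commShift
  let := R.iShriek_commShift
  let := R.jShriek_commShift
  let := R.jPull_commShift
  have := R.iPush_triangulated
  have := R.jShriek_triangulated
  have := R.iPush_full
  have := R.iPush_faithful
  have := R.jShriek_full
  have := R.jShriek_faithful
  have hB := (isPerfect_regularObject k B).map_of_adjunction R.adj₂
  have hC := (isPerfect_regularObject k C).map_of_adjunction R.adj₃
  have hle := strongGlobalDim_le_of_adjunction R.adj₂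
  refine ⟨fun hA ↦ ⟨hle.trans_lt ?_, (strongGlobalDim_le_of_adjunction R.adj₃).trans_lt ?_⟩,
    hB, hle⟩
  · exact WithTop.add_lt_top.2 ⟨hA, hB.objLength_lt_top⟩
  · exact WithTop.add_lt_top.2 ⟨hA, hC.objLength_lt_top⟩
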